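/- **Setting.** Let $\mathbb H^2=\{(x_1,x_2):x_2>0\}$ be the half-plane model of the hyperbolic plane, with metric $g=(dx_1^2+dx_2^2)/x_2^2$, distance $d_g$, measure $d\mu=x_2^{-2}dx_1dx_2$, base point $\mathrm O=(0,1)$, and $\mathrm L^2(\mathbb H^2)=\mathrm L^2(\mathbb H^2,\mu;\mathbb R)$. Let $\Delta_g=x_2^2(\partial_{x_1}^2+\partial_{x_2}^2)$ be the Laplace–Beltrami operator, as a self-adjoint operator on $\mathrm L^2(\mathbb H^2)$ with domain $\{v\in \mathrm L^2:\Delta_g v\in \mathrm L^2\}$ ($\Delta_g v$ in the sense of distributions). Let $\mathcal M$ be the space of $v\in C^6(\mathbb H^2)$ such that for every $w>0$ $$\|v\|_{\mathcal M,w}:=\sum_{\alpha=0}^6\big\|e^{w\,d_g(\mathrm O,\cdot)}|\nabla_g^\alpha v|_g\big\|_{\mathrm L^2(\mathbb H^2)}<\infty ,$$ where $\nabla_g^\alpha$ is the $\alpha$-fold covariant derivative, with the topology given by these norms. For $T>0$, $u_0\in\mathcal M$ and $f\in C([0,T],\mathcal M)$ let $u$ be the solution in $\mathrm L^2(\mathbb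 H^2)$ of $$\partial_t u=\Delta_g u+f\ \text{ on }(0,T],\qquad u(0)=u_0. \tag{1}$$ **Discrete objects.** For each $h>0$ let $(\mathcal C_h^{p})_{p\in Z_1\times Z_2}$, with $Z_1,Z_2\subseteq\mathbb Z$ possibly depending on $h$, be the cells of a grid on $\mathbb H^2$ (measurable sets of positive finite area $|\mathcal C_h^p|_g=\mu(\mathcal C_h^p)$). Let $\ell_h^2$ be the Hilbert space of real grid functions with scalar product $\langle a,b\rangle_{\ell^2_h}=\sum_p|\mathcal C_h^p|_g\,a_pb_p$, let $(\Pi_hv)_p=|\mathcal C_h^p|_g^{-1}\int_{\mathcal C_h^p}v\,d\mu$, and let $\Delta_h$ be a linear operator on $\ell^2_h$ with domain $D(\Delta_h)\subseteq\ell^2_h$ (an abstract discrete Laplacian). Assume that there is $h_0>0$ such that: * (L1) for all $h\in(0,h_0)$ and $v\in \mathrm L^2(\mathbb H^2)$: $\Pi_hv\in\ell_h^2$ and $\|\Pi_hv\|_{\ell_h^2}\le\|v\|_{\mathrm L^2(\mathbb H^2)}$; * (L2) for all $h\in(0,h_0)$, $\Delta_h$ is self-adjoint (in particular densely defined) and m-dissipative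 on $\ell^2_h$, i.e. $\|a\|\le\|a-\lambda\Delta_ha\|$ for all $a\in D(\Delta_h)$, $\lambda>0$, and $\mathrm{id}-\lambda\Delta_h:D(\Delta_h)\to\ell^2_h$ is onto for all $\lambda>0$; * (L3) for all $T>0$, $u_0\in\mathcal M$ and $f\in C([0,T],\mathcal M)$ there is a constant $C_{u_0,f,T}>0$ such that the solution $u$ of (1) satisfies $\Pi_hu(t)\in D(\Delta_h)$ and $$\|\Delta_h\Pi_hu(t)-\Pi_h\Delta_gu(t)\|_{\ell_h^2}\le C_{u_0,f,T}\,h^2\qquad\text{for all }h\in(0,h_0),\ t\in[0,T].$$ **Theorem (convergence of the FDM scheme).** For all $T>0$, $u_0\in\mathcal M$ and $f\in C([0,T],\mathcal M)$ there is a constant $C_{u_0,f,T}>0$ such that for every $h\in(0,h_0)$ and $t\in[0,T]$ $$\|u^h(t)-\Pi_hu(t)\|_{\ell_h^2}\le C_{u_0,f,T}\,h^2 ,$$ where $u$ is the solution of (1) and $u^h\in C([0,T],\ell_h^2)$ is the (mild) solution of the semi-discrete problem $\partial_tu^h=\Delta_hu^h+\Pi_hf$ on $(0,T]$, $u^h(0)=\Pi_hu_0$.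 -/

import Mathlib

open MeasureTheory Filter Topology UpperHalfPlane
open scoped ENNReal

noncomputable section

namespace FDM

/-! ### The hyperbolic plane

The half-plane model is Mathlib's `ℍ`: `dist` is the hyperbolic distance and `volume` is the
hyperbolic measure `dx₁ dx₂ / x₂ ^ 2`. The coordinates are `x₁ = re z` and `x₂ = im z`, and the
base point `O = (0, 1)` is `UpperHalfPlane.I`. -/

/-- The real Hilbert space of square-integrable functions on the hyperbolic plane. -/
abbrev HypL2 : Type := Lp ℝ 2 (volume : Measure ℍ)

open Classical in
/-- The class in `L²(ν)` of a square-integrable function (and `0` for any other function). -/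
def toL2 {α : Type*} [MeasurableSpace α] (ν : Measure α) (v : α → ℝ) : Lp ℝ 2 ν :=
  if hv : MemLp v 2 ν then hv.toLp v else 0

/-- `v` is of class `C^n` on the hyperbolic plane; as `n : ℕ∞`, `n = ⊤` means smooth. -/
def IsCn (n : ℕ∞) (v : ℍ → ℝ) : Prop :=
  ContDiffOn ℝ n (v ∘ ofComplex) {z : ℂ | 0 < z.im}

/-- The coordinate directions: `0` is `x₁`, `1` is `x₂`. -/
def dir (k : Fin 2) : ℂ := if k = 0 then 1 else Complex.I

/-- The partial derivative with respect to the `k`-th coordinate. -/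
def pderiv (k : Fin 2) (v : ℍ → ℝ) (z : ℍ) : ℝ :=
  fderiv ℝ (v ∘ ofComplex) (z : ℂ) (dir k)

/-- The Laplace–Beltrami operator `x₂ ^ 2 (∂₁² + ∂₂²)` on smooth functions. -/
def laplacian (v : ℍ → ℝ) (z : ℍ) : ℝ :=
  z.im ^ 2 * (pderiv 0 (pderiv 0 v) z + pderiv 1 (pderiv 1 v) z)

/-- The Christoffel symbols `Γ^m_{k i}` of the metric `(dx₁² + dx₂²) / x₂²`:
`Γ^0_{01} = Γ^0_{10} = Γ^1_{11} = -1 / x₂`, `Γ^1_{00} = 1 / x₂`, the others vanish. -/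
def christoffel (k i m : Fin 2) (z : ℍ) : ℝ :=
  if m = 0 then (if k = i then 0 else -(1 / z.im))
  else (if k = i then (if k = 0 then 1 / z.im else -(1 / z.im)) else 0)

/-- The covariant derivative of a `(0, n)`-tensor field, given by its components in the
coordinates:
`(∇T)_{k i₁ … iₙ} = ∂ₖ T_{i₁ … iₙ} - ∑ₛ ∑ₘ Γ^m_{k iₛ} T_{i₁ … m … iₙ}`. -/
def covDeriv {n : ℕ} (S : (Fin n → Fin 2) → ℍ → ℝ) : (Fin (n + 1) → Fin 2) → ℍ → ℝ :=
  fun J z => pderiv (J 0) (S (Fin.tail J)) z -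
    ∑ s : Fin n, ∑ m : Fin 2,
      christoffel (J 0) (Fin.tail J s) m z * S (Function.update (Fin.tail J) s m) z

/-- The components of the `n`-fold covariant derivative `∇_g^n v`. -/
def iterCovDeriv (v : ℍ → ℝ) : (n : ℕ) → (Fin n → Fin 2) → ℍ → ℝ
  | 0 => fun _ => v
  | n + 1 => covDeriv (iterCovDeriv v n)

/-- The pointwise norm `|S|_g` of a `(0, n)`-tensor field; the inverse metric is `x₂ ^ 2` times
the identity matrix. -/
def tensorNorm {n : ℕ} (S : (Fin n → Fin 2) → ℍ → ℝ) (z : ℍ) : ℝ :=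
  Real.sqrt (z.im ^ (2 * n) * ∑ J : Fin n → Fin 2, S J z ^ 2)

/-- The weighted norm `∑_{α ≤ 6} ‖e^{w d(O, x)} |∇_g^α v|_g‖_{L²}`, with values in `[0, ∞]`. -/
def weightedNorm (w : ℝ) (v : ℍ → ℝ) : ℝ≥0∞ :=
  ∑ α ∈ Finset.range 7,
    eLpNorm (fun z : ℍ =>
      Real.exp (w * dist UpperHalfPlane.I z) * tensorNorm (iterCovDeriv v α) z) 2 volume

/-- The space `𝓜` of `C⁶` functions all of whose exponentially weighted norms are finite. -/
def MemM (v : ℍ → ℝ) : Prop :=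
  IsCn 6 v ∧ ∀ w : ℝ, 0 < w → weightedNorm w v < ∞

/-- The assumption on the data: `u₀ ∈ 𝓜` and `f ∈ C([0, T], 𝓜)`. -/
structure AdmissibleData (T : ℝ) (u₀ : ℍ → ℝ) (f : ℝ → ℍ → ℝ) : Prop where
  initial : MemM u₀
  source : ∀ t ∈ Set.Icc 0 T, MemM (f t)
  source_continuous : ∀ w : ℝ, 0 < w → ∀ t ∈ Set.Icc 0 T,
    Tendsto (fun s => weightedNorm w (f s - f t)) (𝓝[Set.Icc 0 T] t) (𝓝 0)

/-- `v ∈ D(Δ_g)` and `Δ_g v = w`, where `Δ_g` is the Laplace–Beltrami operator as an unbounded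
operator on `L²`: its domain consists of the `v ∈ L²` whose distributional Laplacian is in `L²`.
(Since the hyperbolic plane is complete, this is the self-adjoint realisation of `Δ_g`.) -/
def HasLaplacian (v w : HypL2) : Prop :=
  ∀ φ : ℍ → ℝ, IsCn ⊤ φ → HasCompactSupport φ →
    ∫ z, v z * laplacian φ z = ∫ z, w z * φ z

/-- `u : [0, T] → L²` is a solution of the heat equation
`∂ₜ u = Δ_g u + f` on `(0, T]`, `u(0) = u₀`. -/
structure IsHeatSolution (T : ℝ) (u₀ : ℍ → ℝ) (f : ℝ → ℍ → ℝ) (u : ℝ → HypL2) : Prop where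
  continuousOn : ContinuousOn u (Set.Icc 0 T)
  initial : u 0 = toL2 volume u₀
  equation : ∀ t ∈ Set.Ioc 0 T, ∃ w : HypL2, HasLaplacian (u t) w ∧
    HasDerivWithinAt u (w + toL2 volume (f t)) (Set.Icc 0 T) t

/-! ### Numerical grids -/

/-- A numerical grid on the hyperbolic plane: measurable cells of positive finite hyperbolic area
indexed by `Z₁ × Z₂` with `Z₁, Z₂ ⊆ ℤ`. -/
structure Grid where
  Z₁ : Set ℤ
  Z₂ : Set ℤ
  cell : Z₁ × Z₂ → Set ℍ
  measurableSet_cell : ∀ p, MeasurableSet (cell p)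
  area_ne_zero : ∀ p, volume (cell p) ≠ 0
  area_ne_top : ∀ p, volume (cell p) ≠ ∞

namespace Grid

variable (G : Grid)

/-- The measure on the index set giving to each index the hyperbolic area of its cell. -/
def weight : Measure (G.Z₁ × G.Z₂) :=
  Measure.sum fun p => volume (G.cell p) • Measure.dirac p

/-- The Hilbert space `ℓ²_h` of grid functions, with scalar product
`⟨u, v⟩ = ∑ₚ |C_p| u_p v_p`. -/
abbrev GridL2 : Type := Lp ℝ 2 G.weight

/-- The mean values of a function over the cells. -/
def cellMean (v : HypL2) (p : G.Z₁ × G.Z₂) : ℝ :=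
  (volume.real (G.cell p))⁻¹ * ∫ z in G.cell p, v z

/-- The projection `Π_h : L² → ℓ²_h`, `(Π_h v)_p = |C_p|⁻¹ ∫_{C_p} v dμ` (used only when all
`Π_h v` belong to `ℓ²_h`). -/
def proj (v : HypL2) : G.GridL2 := toL2 G.weight (G.cellMean v)

/-- (L1) The projection maps `L²` into `ℓ²_h` and is a contraction. -/
def ContractiveProj : Prop :=
  ∀ v : HypL2, MemLp (G.cellMean v) 2 G.weight ∧ ‖G.proj v‖ ≤ ‖v‖

end Grid

/-- m-dissipativity of an unbounded operator `A`: it is dissipative, that is,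
`‖x‖ ≤ ‖x - l A x‖` for `x ∈ D(A)` and `l > 0`, and `x - l A x = y` is solvable for all `l > 0`
and all `y`. -/
structure IsMDissipative {H : Type*} [NormedAddCommGroup H] [InnerProductSpace ℝ H]
    (A : H →ₗ.[ℝ] H) : Prop where
  dissipative : ∀ l : ℝ, 0 < l → ∀ x : A.domain, ‖(x : H)‖ ≤ ‖(x : H) - l • A x‖
  surjective : ∀ l : ℝ, 0 < l → ∀ y : H, ∃ x : A.domain, (x : H) - l • A x = y

/-- `y : [0, T] → H` is the (mild) solution of `y' = A y + g`, `y(0) = x`: it is continuous, and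
for all `t ∈ [0, T]` the integral `∫₀ᵗ y` is in `D(A)` and
`y(t) = x + A ∫₀ᵗ y(s) ds + ∫₀ᵗ g(s) ds`.
For m-dissipative self-adjoint `A` this is equivalent to Duhamel's formula
`y(t) = e^{tA} x + ∫₀ᵗ e^{(t-s)A} g(s) ds`, and every classical solution is of this kind. -/
structure IsSolution {H : Type*} [NormedAddCommGroup H] [InnerProductSpace ℝ H]
    (A : H →ₗ.[ℝ] H) (T : ℝ) (x : H) (g : ℝ → H) (y : ℝ → H) : Prop where
  continuousOn : ContinuousOn y (Set.Icc 0 T)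
  equation : ∀ t ∈ Set.Icc 0 T,
    (∫ s in (0 : ℝ)..t, y s, y t - x - ∫ s in (0 : ℝ)..t, g s) ∈ A.graph

/-- `uh` is the solution of the semi-discrete problem
`∂ₜ uh = Δ_h uh + Π_h f` on `(0, T]`, `uh(0) = Π_h u₀`. -/
def IsSemidiscreteSolution (G : Grid) (L : G.GridL2 →ₗ.[ℝ] G.GridL2) (T : ℝ) (u₀ : ℍ → ℝ)
    (f : ℝ → ℍ → ℝ) (uh : ℝ → G.GridL2) : Prop :=
  IsSolution L T (G.proj (toL2 volume u₀)) (fun t => G.proj (toL2 volume (f t))) uh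

/-- (L3) Consistency of order `h²` along the solutions `u` of the heat equation:
`Π_h u(t) ∈ D(Δ_h)` and `‖Δ_h Π_h u(t) - Π_h Δ_g u(t)‖ ≤ C h²` for `h ∈ (0, h₀)`, `t ∈ [0, T]`,
with `C` depending only on the data `u₀`, `f`, `T` (and on the family of discrete operators). -/
def Consistent (G : ℝ → Grid) (L : (h : ℝ) → (G h).GridL2 →ₗ.[ℝ] (G h).GridL2) (h₀ : ℝ) : Prop :=
  ∀ (T : ℝ) (u₀ : ℍ → ℝ) (f : ℝ → ℍ → ℝ), 0 < T → AdmissibleData T u₀ f →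
    ∃ C : ℝ, 0 < C ∧ ∀ u : ℝ → HypL2, IsHeatSolution T u₀ f u →
      ∀ h ∈ Set.Ioo 0 h₀, ∀ t ∈ Set.Icc 0 T, ∀ w : HypL2, HasLaplacian (u t) w →
        ∃ hu : (G h).proj (u t) ∈ (L h).domain,
          ‖L h ⟨(G h).proj (u t), hu⟩ - (G h).proj w‖ ≤ C * h ^ 2

end FDM

end

open FDM
open scoped InnerProductSpace

namespace FDM

/-! ### Dissipative operators, resolvents and abstract stability. -/

section Resolvent

variable {H : Type*} [NormedAddCommGroup H] [InnerProductSpace ℝ H] {A : H →ₗ.[ℝ] H}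

/-! Consistency plus stability. Since `Π_h` is bounded and linear, the error `e = u^h - Π_h u`
formally satisfies `e' = Δ_h e + r`, `e(0) = 0`, with `r = Δ_h Π_h u - Π_h Δ_g u` of size `C h²` by
(L3). Dissipativity gives `⟪e, e'⟫ ≤ ‖r‖ ‖e‖`, hence `‖e t‖ ≤ C h² t`. As `u^h` is only a mild
solution, `e` need not be differentiable. `IsSolution.norm_sub_le` therefore runs the argument for
`J e`, where `J = (id - l Δ_h)⁻¹` is a contraction commuting with `Δ_h` and `Δ_h J` is bounded. The
bound does not depend on `l`, and `IsMDissipative.norm_le_of_resolvent_le` removes `J`. -/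

theorem IsMDissipative.inner_nonpos (hA : IsMDissipative A) (x : A.domain) :
    ⟪(x : H), A x⟫_ℝ ≤ 0 := by
  have key : ∀ l : ℝ, 0 < l → 2 * ⟪(x : H), A x⟫_ℝ ≤ l * ‖A x‖ ^ 2 := by
    intro l hl
    have h1 := pow_le_pow_left₀ (norm_nonneg _) (hA.dissipative l hl x) 2
    rw [norm_sub_sq_real, inner_smul_right, norm_smul, Real.norm_of_nonneg hl.le] at h1
    refine le_of_mul_le_mul_left ?_ hl
    nlinarith
  by_contra! hpos
  -- This `l` makes `l ‖A x‖²` smaller than the inner product; the `+ 1` covers `A x = 0`.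
  have h2 := key (⟪(x : H), A x⟫_ℝ / (‖A x‖ ^ 2 + 1)) (by positivity)
  rw [div_mul_eq_mul_div, le_div_iff₀ (by positivity)] at h2
  nlinarith [sq_nonneg ‖A x‖]

/-- The resolvent `(id - l A)⁻¹` of an m-dissipative operator is a bounded operator. -/
theorem IsMDissipative.exists_resolvent (hA : IsMDissipative A) {l : ℝ} (hl : 0 < l) :
    ∃ J : H →L[ℝ] H, (∀ y, ‖J y‖ ≤ ‖y‖) ∧
      (∀ y, ∃ hy : J y ∈ A.domain, J y - l • A ⟨J y, hy⟩ = y) ∧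
      ∀ x : A.domain, J (x - l • A x) = x := by
  choose j hj using hA.surjective l hl
  -- Uniqueness of preimages is what makes the chosen inverse linear.
  have huniq : ∀ x x' : A.domain, (x : H) - l • A x = x' - l • A x' → x = x' := by
    intro x x' h
    have h1 := hA.dissipative l hl (x - x')
    rw [LinearPMap.map_sub, smul_sub, Submodule.coe_sub, sub_sub_sub_comm, h, sub_self, norm_zero] at h1
    exact Subtype.ext (sub_eq_zero.mp (norm_le_zero_iff.mp h1))
  let J₀ : H →ₗ[ℝ] H :=
    { toFun := fun y => j y
      map_add' := fun y y' => by
        rw [← Submodule.coe_add]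
        congr 1
        apply huniq
        rw [hj, LinearPMap.map_add, smul_add, Submodule.coe_add, add_sub_add_comm, hj, hj]
      map_smul' := fun c y => by
        rw [RingHom.id_apply, ← Submodule.coe_smul]
        congr 1
        apply huniq
        rw [hj, LinearPMap.map_smul, Submodule.coe_smul, smul_comm, ← smul_sub, hj] }
  have hbound : ∀ y, ‖J₀ y‖ ≤ ‖y‖ := fun y => by
    have h := hA.dissipative l hl (j y)
    rwa [hj] at h
  refine ⟨J₀.mkContinuous 1 fun y => by rw [one_mul]; exact hbound y, hbound,
    fun y => ⟨(j y).2, hj y⟩, fun x => ?_⟩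
  exact congrArg Subtype.val (huniq _ _ (hj _))

/-- The resolvents converge strongly to the identity, in quantified form: a bound on all of
`‖J_l e‖` is a bound on `‖e‖`. -/
theorem IsMDissipative.norm_le_of_resolvent_le (hA : IsMDissipative A)
    (hdense : Dense (A.domain : Set H)) {e : H} {K : ℝ}
    (h : ∀ l : ℝ, 0 < l → ∀ J : H →L[ℝ] H, (∀ y, ‖J y‖ ≤ ‖y‖) →
      (∀ y, ∃ hy : J y ∈ A.domain, J y - l • A ⟨J y, hy⟩ = y) →
      (∀ x : A.domain, J (x - l • A x) = x) → ‖J e‖ ≤ K) : ‖e‖ ≤ K := by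
  refine le_of_forall_pos_le_add fun ε hε => ?_
  obtain ⟨x, hx, hxe⟩ := hdense.exists_dist_lt e (show 0 < ε / 3 by positivity)
  rw [dist_eq_norm] at hxe
  set a : H := A ⟨x, hx⟩ with ha
  -- So small that `‖x - J x‖ = l ‖J A x‖ ≤ ε / 3`.
  have hl : 0 < ε / (3 * (‖a‖ + 1)) := by positivity
  set l := ε / (3 * (‖a‖ + 1)) with hldef
  obtain ⟨J, hJ, hJr, hJl⟩ := hA.exists_resolvent hl
  have hJx : x - J x = -(l • J a) := by
    have := hJl ⟨x, hx⟩
    rw [map_sub, map_smul, ← ha] at this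
    simp only at this
    nth_rewrite 1 [← this]
    abel
  have h1 : ‖x - J x‖ ≤ ε / 3 := by
    rw [hJx, norm_neg, norm_smul, Real.norm_of_nonneg hl.le]
    calc l * ‖J a‖ ≤ l * (‖a‖ + 1) := by gcongr; linarith [hJ a]
      _ = ε / 3 := by rw [hldef]; field_simp
  have h2 : ‖J (e - x)‖ ≤ ε / 3 := (hJ _).trans hxe.le
  calc ‖e‖ = ‖J e + (e - x) + (x - J x) + -J (e - x)‖ := by
        rw [map_sub]; congr 1; abel
    _ ≤ ‖J e‖ + ‖e - x‖ + ‖x - J x‖ + ‖J (e - x)‖ := by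
        refine (norm_add_le _ _).trans ?_
        rw [norm_neg]
        gcongr
        exact norm_add₃_le
    _ ≤ K + ε := by linarith [h l hl J hJ hJr hJl]

/-- A curve starting at `0` with `⟪z, z'⟫ ≤ K ‖z‖` satisfies `‖z t‖ ≤ K t`. -/
theorem norm_le_mul_of_inner_deriv_le {z z' : ℝ → H} {T K : ℝ} (hK : 0 ≤ K)
    (hz : ContinuousOn z (Set.Icc 0 T)) (hz₀ : z 0 = 0)
    (hderiv : ∀ t ∈ Set.Ioo 0 T, HasDerivAt z (z' t) t)
    (hle : ∀ t ∈ Set.Ioo 0 T, ⟪z t, z' t⟫_ℝ ≤ K * ‖z t‖) {t : ℝ} (ht : t ∈ Set.Icc 0 T) :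
    ‖z t‖ ≤ K * t := by
  refine le_of_forall_pos_le_add fun δ hδ => ?_
  -- The norm may fail to be differentiable at `0`, so it is smoothed to `√(‖z‖² + δ²)`, which
  -- starts at `δ`.
  have hpos : ∀ s, 0 < ‖z s‖ ^ 2 + δ ^ 2 := fun s => by positivity
  have hd : ∀ s ∈ Set.Ioo 0 T, HasDerivAt (fun s => √(‖z s‖ ^ 2 + δ ^ 2) - K * s)
      (2 * ⟪z s, z' s⟫_ℝ / (2 * √(‖z s‖ ^ 2 + δ ^ 2)) - K * 1) s := fun s hs =>
    (((hderiv s hs).norm_sq.add_const _).sqrt (hpos s).ne').sub ((hasDerivAt_id s).const_mul K)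
  have hanti : AntitoneOn (fun s => √(‖z s‖ ^ 2 + δ ^ 2) - K * s) (Set.Icc 0 T) := by
    refine antitoneOn_of_deriv_nonpos (convex_Icc 0 T) ?_ ?_ ?_
    · exact (((hz.norm.pow 2).add continuousOn_const).sqrt).sub
        (continuousOn_const.mul continuousOn_id)
    · rw [interior_Icc]
      exact fun s hs => (hd s hs).differentiableAt.differentiableWithinAt
    · rw [interior_Icc]
      intro s hs
      rw [(hd s hs).deriv, mul_div_mul_left _ _ two_ne_zero, mul_one, sub_nonpos,
        div_le_iff₀ (Real.sqrt_pos.mpr (hpos s))]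
      refine (hle s hs).trans ?_
      gcongr
      exact Real.le_sqrt_of_sq_le (by nlinarith [sq_nonneg δ])
  have h := hanti (Set.left_mem_Icc.mpr (ht.1.trans ht.2)) ht ht.1
  simp only [hz₀, norm_zero, mul_zero, sub_zero] at h
  rw [zero_pow two_ne_zero, zero_add, Real.sqrt_sq hδ.le] at h
  have h2 : ‖z t‖ ≤ √(‖z t‖ ^ 2 + δ ^ 2) := Real.le_sqrt_of_sq_le (by nlinarith [sq_nonneg δ])
  linarith

theorem hasDerivAt_integral_of_continuousOn_Icc [CompleteSpace H] {g : ℝ → H} {T : ℝ}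
    (hg : ContinuousOn g (Set.Icc 0 T)) {t : ℝ} (ht : t ∈ Set.Ioo 0 T) :
    HasDerivAt (fun t => ∫ s in (0 : ℝ)..t, g s) (g t) t := by
  have hnhds : Set.Icc 0 T ∈ 𝓝 t := Icc_mem_nhds ht.1 ht.2
  refine intervalIntegral.integral_hasDerivAt_right ?_ ?_ (hg.continuousAt hnhds)
  · exact (hg.mono (Set.Icc_subset_Icc_right ht.2.le)).intervalIntegrable_of_Icc ht.1.le
  · exact ⟨_, hnhds, hg.aestronglyMeasurable measurableSet_Icc⟩

/-- Stability of the abstract Cauchy problem `y' = A y + g` under a perturbation of the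
right-hand side, for a mild solution `y` and a strong solution `v` of the perturbed problem. -/
theorem IsSolution.norm_sub_le [CompleteSpace H] (hA : IsMDissipative A)
    (hdense : Dense (A.domain : Set H)) {T K : ℝ} (hK : 0 ≤ K) {x : H} {g y v : ℝ → H}
    (hy : IsSolution A T x g y) (hg : ContinuousOn g (Set.Icc 0 T))
    (hv : ContinuousOn v (Set.Icc 0 T)) (hv₀ : v 0 = x)
    (hvd : ∀ t ∈ Set.Ioo 0 T, ∃ (ht : v t ∈ A.domain) (w : H),
      ‖A ⟨v t, ht⟩ - w‖ ≤ K ∧ HasDerivAt v (w + g t) t) {t : ℝ} (ht : t ∈ Set.Icc 0 T) :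
    ‖y t - v t‖ ≤ K * t := by
  refine hA.norm_le_of_resolvent_le hdense fun l hl J hJ hJr hJl => ?_
  choose! hdom w hw hvderiv using hvd
  choose hJdom hJr using hJr
  -- The Yosida approximation: `A J = B` everywhere and `J A = B` on the domain.
  let B : H →L[ℝ] H := l⁻¹ • (J - ContinuousLinearMap.id ℝ H)
  have hAJ : ∀ a, A ⟨J a, hJdom a⟩ = B a := fun a => by
    have : l • A ⟨J a, hJdom a⟩ = J a - a := by
      rw [eq_sub_iff_add_eq, ← eq_sub_iff_add_eq', hJr]
    change _ = l⁻¹ • (J a - a)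
    rw [← this, smul_smul, inv_mul_cancel₀ hl.ne', one_smul]
  have hJA : ∀ a : A.domain, J (A a) = B a := fun a => by
    have := hJl a
    rw [map_sub, map_smul] at this
    change _ = l⁻¹ • (J a - (a : H))
    rw [← eq_sub_iff_add_eq.mpr (sub_eq_iff_eq_add'.mp this).symm, smul_smul, inv_mul_cancel₀ hl.ne', one_smul]
  -- Under `J` the unbounded `A` in the mild equation becomes the bounded `B`, so the right-hand
  -- side is differentiable.
  have hJy : ∀ s ∈ Set.Icc 0 T,
      J (y s) = B (∫ r in (0 : ℝ)..s, y r) + J x + J (∫ r in (0 : ℝ)..s, g r) := by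
    intro s hs
    obtain ⟨a, ha, ha'⟩ := (LinearPMap.mem_graph_iff A).mp (hy.equation s hs)
    simp only at ha ha'
    rw [← ha, ← hJA a, ha', ← map_add, ← map_add]
    congr 1
    abel
  have hy₀ : y 0 = x := by
    obtain ⟨a, ha, ha'⟩ := (LinearPMap.mem_graph_iff A).mp
      (hy.equation 0 (Set.left_mem_Icc.mpr (ht.1.trans ht.2)))
    simp only [intervalIntegral.integral_same, sub_zero] at ha ha'
    rw [show a = 0 from Subtype.ext ha, LinearPMap.map_zero] at ha'
    exact (sub_eq_zero.mp ha'.symm)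
  have hderiv : ∀ s ∈ Set.Ioo 0 T, HasDerivAt (fun s => J (y s - v s))
      (B (y s) + J (g s) - J (w s + g s)) s := by
    intro s hs
    have h1 : HasDerivAt (fun s => J (y s)) (B (y s) + J (g s)) s := by
      have h2 := ((B.hasFDerivAt.comp_hasDerivAt s
        (hasDerivAt_integral_of_continuousOn_Icc hy.continuousOn hs)).add_const (J x)).add
        (J.hasFDerivAt.comp_hasDerivAt s (hasDerivAt_integral_of_continuousOn_Icc hg hs))
      refine h2.congr_of_eventuallyEq ?_
      filter_upwards [Icc_mem_nhds hs.1 hs.2] with r hr using hJy r hr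
    simp only [map_sub]
    exact h1.sub (J.hasFDerivAt.comp_hasDerivAt s (hvderiv s hs))
  refine norm_le_mul_of_inner_deriv_le (z := fun s => J (y s - v s)) hK
    (J.continuous.comp_continuousOn (hy.continuousOn.sub hv)) ?_ hderiv ?_ ht
  · simp only [hy₀, hv₀, sub_self, map_zero]
  · intro s hs
    -- A dissipative term plus the consistency defect, which `J` does not enlarge.
    have h1 : B (y s) + J (g s) - J (w s + g s) =
        A ⟨J (y s - v s), hJdom _⟩ + J (A ⟨v s, hdom s hs⟩ - w s) := by
      rw [hAJ, map_sub J, hJA, map_sub, map_add]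
      abel
    rw [h1, inner_add_right]
    have h2 := hA.inner_nonpos ⟨J (y s - v s), hJdom _⟩
    have h3 : ⟪J (y s - v s), J (A ⟨v s, hdom s hs⟩ - w s)⟫_ℝ ≤ K * ‖J (y s - v s)‖ := by
      refine (real_inner_le_norm _ _).trans ?_
      rw [mul_comm]
      gcongr
      exact (hJ _).trans (hw s hs)
    linarith

end Resolvent

/-! ### From the topology of `𝓜` to `L²`. -/

section Data

theorem toL2_of_memLp {α : Type*} [MeasurableSpace α] {ν : Measure α} {v : α → ℝ}
    (hv : MemLp v 2 ν) : toL2 ν v = hv.toLp v := dif_pos hv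

theorem IsCn.continuous {n : ℕ∞} {v : ℍ → ℝ} (hv : IsCn n v) : Continuous v := by
  have h := hv.continuousOn.comp_continuous UpperHalfPlane.continuous_coe fun z => z.im_pos
  refine h.congr fun z => ?_
  simp [ofComplex_apply]

/-- The term `α = 0` suffices, its weight being at least `1`. -/
theorem eLpNorm_le_weightedNorm {w : ℝ} (hw : 0 ≤ w) (v : ℍ → ℝ) :
    eLpNorm v 2 volume ≤ weightedNorm w v := by
  refine le_trans ?_ (Finset.single_le_sum (fun _ _ => zero_le) (Finset.mem_range.mpr
    (show 0 < 7 by norm_num)))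
  refine eLpNorm_mono fun z => ?_
  have h1 : tensorNorm (iterCovDeriv v 0) z = |v z| := by
    simp [tensorNorm, iterCovDeriv, Real.sqrt_sq_eq_abs]
  rw [h1, norm_mul, Real.norm_eq_abs, Real.norm_eq_abs, Real.norm_eq_abs, abs_abs, Real.abs_exp]
  exact le_mul_of_one_le_left (abs_nonneg _) (Real.one_le_exp (mul_nonneg hw dist_nonneg))

theorem MemM.memLp {v : ℍ → ℝ} (hv : MemM v) : MemLp v 2 volume :=
  ⟨hv.1.continuous.aestronglyMeasurable,
    (eLpNorm_le_weightedNorm zero_le_one v).trans_lt (hv.2 1 one_pos)⟩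

theorem AdmissibleData.continuousOn_toL2 {T : ℝ} {u₀ : ℍ → ℝ} {f : ℝ → ℍ → ℝ}
    (h : AdmissibleData T u₀ f) :
    ContinuousOn (fun t => toL2 volume (f t)) (Set.Icc 0 T) := by
  intro t ht
  rw [ContinuousWithinAt, tendsto_iff_edist_tendsto_0]
  refine tendsto_of_tendsto_of_tendsto_of_le_of_le' tendsto_const_nhds
    (h.source_continuous 1 one_pos t ht) (Eventually.of_forall fun _ => zero_le) ?_
  filter_upwards [self_mem_nhdsWithin] with s hs
  rw [toL2_of_memLp (h.source s hs).memLp, toL2_of_memLp (h.source t ht).memLp,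
    Lp.edist_toLp_toLp]
  exact eLpNorm_le_weightedNorm zero_le_one _

end Data

/-! ### Linearity of the cell averages. -/

namespace Grid

variable {G : Grid}

theorem integrableOn_cell (v : HypL2) (p : G.Z₁ × G.Z₂) : IntegrableOn v (G.cell p) volume := by
  have : IsFiniteMeasure (volume.restrict (G.cell p)) :=
    ⟨by rw [Measure.restrict_apply_univ]; exact (G.area_ne_top p).lt_top⟩
  exact ((Lp.memLp v).restrict _).integrable (by norm_num)

theorem cellMean_add (v w : HypL2) : G.cellMean (v + w) = G.cellMean v + G.cellMean w := by
  ext p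
  have h : ∫ z in G.cell p, (v + w : HypL2) z = ∫ z in G.cell p, (v z + w z) :=
    integral_congr_ae (ae_restrict_of_ae (Lp.coeFn_add v w))
  rw [Pi.add_apply, cellMean, h, integral_add (integrableOn_cell v p) (integrableOn_cell w p),
    mul_add, cellMean, cellMean]

theorem cellMean_smul (c : ℝ) (v : HypL2) : G.cellMean (c • v) = c • G.cellMean v := by
  ext p
  have h : ∫ z in G.cell p, (c • v : HypL2) z = ∫ z in G.cell p, c * v z :=
    integral_congr_ae (ae_restrict_of_ae (Lp.coeFn_smul c v))
  rw [Pi.smul_apply, cellMean, h, integral_const_mul, cellMean, smul_eq_mul, mul_left_comm]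

/-- Under (L1) the projection is a bounded linear operator. -/
theorem ContractiveProj.exists_clm (hG : G.ContractiveProj) :
    ∃ P : HypL2 →L[ℝ] G.GridL2, ∀ v, P v = G.proj v := by
  let P₀ : HypL2 →ₗ[ℝ] G.GridL2 :=
    { toFun := G.proj
      map_add' := fun v w => by
        -- (L1) excludes the default value `0` of `toL2`, which could break additivity.
        simp only [proj, toL2_of_memLp (hG _).1]
        rw [← MemLp.toLp_add]
        simp only [cellMean_add]
      map_smul' := fun c v => by
        simp only [proj, toL2_of_memLp (hG _).1, RingHom.id_apply]
        rw [← MemLp.toLp_const_smul]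
        simp only [cellMean_smul] }
  exact ⟨P₀.mkContinuous 1 fun v => by rw [one_mul]; exact (hG v).2, fun _ => rfl⟩

end Grid

end FDM

/-! ### The convergence estimate. -/

theorem mainTheorem2
    (G : ℝ → FDM.Grid)
    (L : (h : ℝ) → (G h).GridL2 →ₗ.[ℝ] (G h).GridL2)
    (h₀ : ℝ) (hh₀ : 0 < h₀)
    (hL1 : ∀ h ∈ Set.Ioo 0 h₀, (G h).ContractiveProj)
    (hL2 : ∀ h ∈ Set.Ioo 0 h₀, IsSelfAdjoint (L h) ∧ FDM.IsMDissipative (L h))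
    (hL3 : FDM.Consistent G L h₀)
    (T : ℝ) (hT : 0 < T) (u₀ : ℍ → ℝ) (f : ℝ → ℍ → ℝ)
    (hdata : FDM.AdmissibleData T u₀ f) :
    ∃ C : ℝ, 0 < C ∧
      ∀ u : ℝ → FDM.HypL2, FDM.IsHeatSolution T u₀ f u →
      ∀ h ∈ Set.Ioo 0 h₀, ∀ uh : ℝ → (G h).GridL2,
        FDM.IsSemidiscreteSolution (G h) (L h) T u₀ f uh →
        ∀ t ∈ Set.Icc 0 T, ‖uh t - (G h).proj (u t)‖ ≤ C * h ^ 2 := by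
  obtain ⟨C, hC, hcons⟩ := hL3 T u₀ f hT hdata
  refine ⟨C * T, mul_pos hC hT, fun u hu h hh uh huh t ht => ?_⟩
  obtain ⟨P, hP⟩ := (hL1 h hh).exists_clm
  have hCh : 0 ≤ C * h ^ 2 := by positivity
  have hbound : ‖uh t - (G h).proj (u t)‖ ≤ C * h ^ 2 * t := by
    -- Self-adjointness enters through the density of the domain.
    refine FDM.IsSolution.norm_sub_le (v := fun s => (G h).proj (u s)) (hL2 h hh).2
      (hL2 h hh).1.dense_domain hCh huh ?_ ?_ ?_ ?_ ht
    · simpa only [hP, Function.comp_def] using P.continuous.comp_continuousOn hdata.continuousOn_toL2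
    · simpa only [hP, Function.comp_def] using P.continuous.comp_continuousOn hu.continuousOn
    · simp only [hu.initial]
    · intro s hs
      obtain ⟨w, hw, hderiv⟩ := hu.equation s (Set.Ioo_subset_Ioc_self hs)
      obtain ⟨hdom, hle⟩ := hcons u hu h hh s (Set.Ioo_subset_Icc_self hs) w hw
      refine ⟨hdom, (G h).proj w, hle, ?_⟩
      have hd := P.hasFDerivAt.comp_hasDerivAt s (hderiv.hasDerivAt (Icc_mem_nhds hs.1 hs.2))
      rw [map_add] at hd
      simpa only [hP, Function.comp_def] using hd
  calc ‖uh t - (G h).proj (u t)‖ ≤ C * h ^ 2 * t := hbound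
    _ ≤ C * h ^ 2 * T := mul_le_mul_of_nonneg_left ht.2 hCh
    _ = C * T * h ^ 2 := by ring
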